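/- Let $G$ be a locally compact group (possibly discrete) and $H$ a closed subgroup. Write $H\backslash G$ for the space of right cosets $Hx$ with the quotient topology. The pair $(G,H)$ is called a discrete Hecke pair if $H\backslash G$ is discrete and $[H:H\cap xHx^{-1}]<\infty$ for all $x\in G$. A discrete Hecke pair is called finitely generated if it has a compact (for instance, a finite) generating set, that is, if there is a compact set $S\subseteq G$ such that $H\backslash G=\bigcup_{n\in\mathbb N}H\hat S^{\,n}$, where $\hat S=S\cup S^{-1}\cup\{e\}$. A length function on the pair $(G,H)$ is a Borel function $l\colon G\to[0,\infty)$ such that $l(e)=0$, $l(g)=l(g^{-1})$ and $l(gh)\le l(g)+l(h)$ for all $g,h\in G$, and such that $l(h)=0$ for all $h\in H$; it is then constant on each coset $Hg$. It is called locally bounded if it is bounded on every compact subset of $H\backslash G$, and proper if for every $n\in\mathbb N$ the image of $l^{-1}([0,n])$ in $H\backslash G$ is relatively compact. Lemma. Let $(G,H)$ be a finitely generated discrete Hecke pair. Then there exists a locally bounded and proper length function on $(G,H)$. -/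

import Mathlib

open scoped NNReal Pointwise

/-- The homogeneous space `H \ G` of right cosets `H x`; it carries the quotient topology. -/
abbrev RightCosetSpace {G : Type*} [Group G] (H : Subgroup G) : Type _ :=
  Quotient (QuotientGroup.rightRel H)

/-- The canonical projection `G → H \ G`, `x ↦ H x`. -/
def toRightCoset {G : Type*} [Group G] (H : Subgroup G) (x : G) : RightCosetSpace H :=
  Quotient.mk (QuotientGroup.rightRel H) x

/-- The number `L(x) = [H : H ∩ x H x⁻¹]`, with the value `0` when this index is infinite. -/
noncomputable def heckeIndex {G : Type*} [Group G] (H : Subgroup G) (x : G) : ℕ :=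
  (H ⊓ H.map (MulAut.conj x).toMonoidHom).relIndex H

/-- `(G, H)` is a discrete Hecke pair: `H` is a closed subgroup of `G`, the homogeneous space
`H \ G` is discrete, and `L(x) < ∞` for all `x`. -/
structure IsDiscreteHeckePair {G : Type*} [Group G] [TopologicalSpace G]
    (H : Subgroup G) : Prop where
  isClosed : IsClosed (H : Set G)
  discrete : DiscreteTopology (RightCosetSpace H)
  index_finite : ∀ x : G, heckeIndex H x ≠ 0

/-- `S` is a generating set of the pair `(G, H)`: `H \ G = ⋃ₙ H Ŝⁿ`, `Ŝ = S ∪ S⁻¹ ∪ {e}`. -/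
def IsGeneratingSetOfPair {G : Type*} [Group G] (H : Subgroup G) (S : Set G) : Prop :=
  ⋃ n : ℕ, toRightCoset H '' ((S ∪ S⁻¹ ∪ {1}) ^ n) = Set.univ

/-- The pair `(G, H)` has a compact generating set. -/
def IsCompactlyGeneratedPair {G : Type*} [Group G] [TopologicalSpace G]
    (H : Subgroup G) : Prop :=
  ∃ S : Set G, IsCompact S ∧ IsGeneratingSetOfPair H S

/-- A length function on a topological group `G`: a Borel function `G → [0, ∞)` which vanishes at
the identity, is symmetric, and is subadditive. -/
structure IsLengthFunction {G : Type*} [Group G] [TopologicalSpace G] (l : G → ℝ≥0) : Prop where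
  borel : @Measurable G ℝ≥0 (borel G) inferInstance l
  one : l 1 = 0
  inv : ∀ g : G, l g = l g⁻¹
  mul_le : ∀ g h : G, l (g * h) ≤ l g + l h

/-- The kernel `N_l = {g ∈ G | l(g) = 0}`. -/
def lengthKernel {G : Type*} (l : G → ℝ≥0) : Set G := {g | l g = 0}

/-- A length function on the pair `(G, H)`: one on `G` whose kernel contains `H`. -/
structure IsLengthFunctionOfPair {G : Type*} [Group G] [TopologicalSpace G]
    (H : Subgroup G) (l : G → ℝ≥0) : Prop extends IsLengthFunction l where
  subset_kernel : (H : Set G) ⊆ lengthKernel l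

/-- `l`, viewed as a function of the coset `H g`, is bounded on every compact subset of `H \ G`. -/
def IsLocallyBoundedOnPair {G : Type*} [Group G] [TopologicalSpace G]
    (H : Subgroup G) (l : G → ℝ≥0) : Prop :=
  ∀ K : Set (RightCosetSpace H), IsCompact K →
    ∃ C : ℝ≥0, ∀ g : G, toRightCoset H g ∈ K → l g ≤ C

/-- For every `n`, the image of `l⁻¹([0, n])` in `H \ G` is relatively compact. -/
def IsProperOnPair {G : Type*} [Group G] [TopologicalSpace G]
    (H : Subgroup G) (l : G → ℝ≥0) : Prop :=
  ∀ n : ℕ, IsCompact (closure (toRightCoset H '' (l ⁻¹' Set.Iic (n : ℝ≥0))))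

/-! Put `A = S ∪ S⁻¹ ∪ {1}` and `T = HAH`, and let `l g` be the least `n` with `g ∈ H Tⁿ`. As `T` is
symmetric and `HT = T = TH`, this word length is symmetric, subadditive and zero on `H`, hence
constant on right cosets; discreteness of `H \ G` then gives continuity and local boundedness.
Properness is where the Hecke condition enters: it splits each double coset into finitely many right
cosets, so every `Tⁿ` meets only finitely many. -/

theorem toRightCoset_eq_iff {G : Type*} [Group G] {H : Subgroup G} {x y : G} :
    toRightCoset H x = toRightCoset H y ↔ y * x⁻¹ ∈ H := by
  unfold toRightCoset
  rw [Quotient.eq, QuotientGroup.rightRel_apply]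

/-- If `L(x⁻¹)` is finite then `H x H` is a finite union of right cosets of `H`. -/
theorem finite_image_mul_subgroup {G : Type*} [Group G] {H : Subgroup G} {x : G}
    (hx : heckeIndex H x⁻¹ ≠ 0) : (Set.range fun h : H => toRightCoset H (x * h)).Finite := by
  set K := (H ⊓ H.map (MulAut.conj x⁻¹).toMonoidHom).subgroupOf H with hK
  have : K.FiniteIndex := ⟨hx⟩
  -- `H x h` depends only on `K h`, while `H ⧸ K` consists of left cosets, hence the inverse.
  let f : H ⧸ K → RightCosetSpace H := Quotient.lift (fun h : H => toRightCoset H (x * (h⁻¹ : H)))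
    (by
      intro a b hab
      have hab' := QuotientGroup.leftRel_apply.1 hab
      rw [hK, Subgroup.mem_subgroupOf] at hab'
      obtain ⟨c, hc, hce⟩ := hab'.2
      rw [toRightCoset_eq_iff]
      have hce' : x⁻¹ * c * x = (a : G)⁻¹ * b := by simpa using hce
      have : x * ((b⁻¹ : H) : G) * (x * ((a⁻¹ : H) : G))⁻¹ = c⁻¹ := by
        have : c = x * ((a : G)⁻¹ * b) * x⁻¹ := by rw [← hce']; group
        rw [this]; push_cast; group
      rw [this]
      exact H.inv_mem hc)
  refine (Set.finite_range f).subset ?_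
  rintro _ ⟨h, rfl⟩
  exact ⟨QuotientGroup.mk h⁻¹, by simp [f, QuotientGroup.mk]⟩

/-- A set meeting finitely many right cosets of `H` still does so after saturating it on
both sides by `H`. -/
theorem finite_image_doubleCoset {G : Type*} [Group G] {H : Subgroup G}
    (hH : ∀ x, heckeIndex H x ≠ 0) {A : Set G} (hA : (toRightCoset H '' A).Finite) :
    (toRightCoset H '' ((H : Set G) * A * H)).Finite := by
  refine (hA.biUnion fun q _ => finite_image_mul_subgroup (hH q.out⁻¹)).subset ?_
  rintro _ ⟨_, ⟨_, ⟨h, hh, a, ha, rfl⟩, k, hk, rfl⟩, rfl⟩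
  refine Set.mem_biUnion ⟨a, ha, rfl⟩ ⟨⟨k, hk⟩, toRightCoset_eq_iff.2 ?_⟩
  have hax : a * (toRightCoset H a).out⁻¹ ∈ H := toRightCoset_eq_iff.1 (Quotient.out_eq _)
  convert H.mul_mem hh hax using 1
  simp only
  group

/-- Since `A` absorbs `H` on the right, each `b ∈ B` may be replaced by a fixed representative of `H
b`; right translation by it acts on right cosets. -/
theorem finite_image_mul {G : Type*} [Group G] {H : Subgroup G} {A B : Set G}
    (hAH : A * (H : Set G) = A)
    (hA : (toRightCoset H '' A).Finite) (hB : (toRightCoset H '' B).Finite) :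
    (toRightCoset H '' (A * B)).Finite := by
  have key : ∀ b : G, (toRightCoset H '' (A * {b})).Finite := by
    intro b
    refine (hA.image (Quotient.lift (fun a => toRightCoset H (a * b)) ?_)).subset ?_
    · intro x y hxy
      rw [toRightCoset_eq_iff]
      simpa [mul_assoc] using QuotientGroup.rightRel_apply.1 hxy
    · rintro _ ⟨_, ⟨a, ha, c, rfl, rfl⟩, rfl⟩
      exact ⟨toRightCoset H a, ⟨a, ha, rfl⟩, rfl⟩
  refine (hB.biUnion fun q _ => key q.out).subset ?_
  rintro _ ⟨_, ⟨a, ha, b, hb, rfl⟩, rfl⟩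
  refine Set.mem_biUnion ⟨b, hb, rfl⟩ ⟨a * b, ⟨a * (b * (toRightCoset H b).out⁻¹), ?_,
    _, rfl, by group⟩, rfl⟩
  rw [← hAH]
  refine Set.mul_mem_mul ha (toRightCoset_eq_iff.1 ?_)
  exact Quotient.out_eq _

theorem finite_image_subgroup_mul {G : Type*} [Group G] {H : Subgroup G} {A : Set G}
    (hA : (toRightCoset H '' A).Finite) : (toRightCoset H '' ((H : Set G) * A)).Finite := by
  refine hA.subset ?_
  rintro _ ⟨_, ⟨h, hh, a, ha, rfl⟩, rfl⟩
  exact ⟨a, ha, toRightCoset_eq_iff.2 (by simpa using hh)⟩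

theorem continuous_toRightCoset {G : Type*} [Group G] [TopologicalSpace G] (H : Subgroup G) :
    Continuous (toRightCoset H) :=
  continuous_quotient_mk'

/-- A subadditive function vanishing on `H` is constant on right cosets of `H`. -/
theorem eq_of_toRightCoset_eq {G : Type*} [Group G] {H : Subgroup G} {l : G → ℝ≥0}
    (hmul : ∀ g h, l (g * h) ≤ l g + l h) (hl : ∀ h ∈ H, l h = 0) {x y : G}
    (hxy : toRightCoset H x = toRightCoset H y) : l x = l y := by
  have key : ∀ {x y : G}, toRightCoset H x = toRightCoset H y → l y ≤ l x := by
    intro x y h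
    simpa [hl _ (toRightCoset_eq_iff.1 h)] using hmul (y * x⁻¹) x
  exact le_antisymm (key hxy.symm) (key hxy)

/-- If `H \ G` is discrete, a function constant on right cosets is continuous. -/
theorem continuous_of_toRightCoset_eq {G : Type*} [Group G] [TopologicalSpace G]
    {H : Subgroup G} [DiscreteTopology (RightCosetSpace H)] {l : G → ℝ≥0}
    (hl : ∀ x y, toRightCoset H x = toRightCoset H y → l x = l y) : Continuous l := by
  have : l = (fun q : RightCosetSpace H => l q.out) ∘ toRightCoset H := by
    ext x
    exact congrArg _ (hl _ _ (Quotient.out_eq (toRightCoset H x)).symm)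
  rw [this]
  exact continuous_of_discreteTopology.comp (continuous_toRightCoset H)

/-- If `H \ G` is discrete, a function constant on right cosets is locally bounded on the pair. -/
theorem isLocallyBoundedOnPair_of_toRightCoset_eq {G : Type*} [Group G] [TopologicalSpace G]
    {H : Subgroup G} [DiscreteTopology (RightCosetSpace H)] {l : G → ℝ≥0}
    (hl : ∀ x y, toRightCoset H x = toRightCoset H y → l x = l y) :
    IsLocallyBoundedOnPair H l := by
  intro K hK
  obtain ⟨C, hC⟩ := (hK.finite_of_discrete.image fun q => l q.out).bddAbove
  refine ⟨C, fun g hg => hC ⟨_, hg, ?_⟩⟩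
  exact hl _ _ (Quotient.out_eq (toRightCoset H g))

/-- The smallest `n` with `g ∈ H Tⁿ`. -/
noncomputable def cosetWordLength {G : Type*} [Group G] (H : Subgroup G) (T : Set G) (g : G) : ℕ :=
  sInf {n | g ∈ (H : Set G) * T ^ n}

section cosetWordLength

variable {G : Type*} [Group G] {H : Subgroup G} {T : Set G}

theorem cosetWordLength_le {n : ℕ} {g : G} (hg : g ∈ (H : Set G) * T ^ n) :
    cosetWordLength H T g ≤ n :=
  Nat.sInf_le hg

/-- `hT` rules out the default value `sInf ∅ = 0`. -/
theorem mem_mul_pow_cosetWordLength (hT : ∀ g : G, ∃ n : ℕ, g ∈ (H : Set G) * T ^ n) (g : G) :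
    g ∈ (H : Set G) * T ^ cosetWordLength H T g :=
  Nat.sInf_mem (hT g)

theorem cosetWordLength_eq_zero {g : G} (hg : g ∈ H) : cosetWordLength H T g = 0 :=
  Nat.le_zero.1 (cosetWordLength_le (by simpa using hg))

/-- Commutation gives `H Tᵐ H Tⁿ = H Tᵐ⁺ⁿ`. -/
theorem cosetWordLength_mul_le (hT : ∀ g : G, ∃ n : ℕ, g ∈ (H : Set G) * T ^ n)
    (hHT : Commute (H : Set G) T) (g h : G) :
    cosetWordLength H T (g * h) ≤ cosetWordLength H T g + cosetWordLength H T h := by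
  refine cosetWordLength_le ?_
  have := Set.mul_mem_mul (mem_mul_pow_cosetWordLength hT g) (mem_mul_pow_cosetWordLength hT h)
  rwa [mul_assoc, ← mul_assoc (T ^ _), ← (hHT.pow_right _).eq, mul_assoc, ← pow_add, ← mul_assoc,
    coe_mul_coe] at this

theorem cosetWordLength_inv (hT : ∀ g : G, ∃ n : ℕ, g ∈ (H : Set G) * T ^ n)
    (hHT : Commute (H : Set G) T) (hinv : T⁻¹ = T) (g : G) :
    cosetWordLength H T g = cosetWordLength H T g⁻¹ := by
  have key : ∀ g : G, cosetWordLength H T g⁻¹ ≤ cosetWordLength H T g := by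
    intro g
    refine cosetWordLength_le ?_
    have := Set.inv_mem_inv.2 (mem_mul_pow_cosetWordLength hT g)
    rwa [mul_inv_rev, ← inv_pow, hinv, inv_coe_set, ← (hHT.pow_right _).eq] at this
  exact le_antisymm (by simpa using key g⁻¹) (key g)

end cosetWordLength

theorem mainTheorem7 {G : Type*} [Group G] [TopologicalSpace G] [IsTopologicalGroup G]
    [LocallyCompactSpace G] (H : Subgroup G) (hH : IsDiscreteHeckePair H)
    (hgen : IsCompactlyGeneratedPair H) :
    ∃ l : G → ℝ≥0, IsLengthFunctionOfPair H l ∧ IsLocallyBoundedOnPair H l ∧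
      IsProperOnPair H l := by
  obtain ⟨S, hS, hSgen⟩ := hgen
  have := hH.discrete
  set A : Set G := S ∪ S⁻¹ ∪ {1} with hA
  have hAfin : (toRightCoset H '' A).Finite :=
    (((hS.union hS.inv).union isCompact_singleton).image
      (continuous_toRightCoset H)).finite_of_discrete
  have hAinv : A⁻¹ = A := by
    rw [hA, Set.union_inv, Set.union_inv, inv_inv, Set.union_comm S⁻¹, Set.inv_singleton, inv_one]
  set T : Set G := (H : Set G) * A * H with hTdef
  have hTH : T * H = T := by rw [hTdef, mul_assoc, coe_mul_coe]
  have hHT : (H : Set G) * T = T := by rw [hTdef, ← mul_assoc, ← mul_assoc, coe_mul_coe]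
  have hcomm : Commute (H : Set G) T := hHT.trans hTH.symm
  have hTinv : T⁻¹ = T := by
    rw [hTdef, mul_inv_rev, mul_inv_rev, inv_coe_set, hAinv, mul_assoc]
  have hAT : A ⊆ T := fun a ha =>
    ⟨1 * a, Set.mul_mem_mul H.one_mem ha, 1, H.one_mem, by simp⟩
  have h1T : (1 : G) ∈ T := hAT (Or.inr rfl)
  have hTfin : ∀ n : ℕ, (toRightCoset H '' (T ^ n)).Finite := by
    intro n
    induction n with
    | zero => simp
    | succ n ih =>
      -- `T` must be the left factor: `T⁰ = {1}` need not absorb `H`.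
      rw [pow_succ']
      exact finite_image_mul hTH (finite_image_doubleCoset hH.index_finite hAfin) ih
  have hT : ∀ g : G, ∃ n : ℕ, g ∈ (H : Set G) * T ^ n := by
    intro g
    have hg : toRightCoset H g ∈ ⋃ n : ℕ, toRightCoset H '' (A ^ n) := by
      rw [show _ = _ from hSgen]; trivial
    obtain ⟨n, a, ha, hag⟩ := Set.mem_iUnion.1 hg
    exact ⟨n, _, toRightCoset_eq_iff.1 hag, a, Set.pow_subset_pow_left hAT ha, by simp⟩
  let l : G → ℝ≥0 := fun g => (cosetWordLength H T g : ℝ≥0)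
  have hlH : ∀ h ∈ H, l h = 0 := fun h hh => by simp [l, cosetWordLength_eq_zero hh]
  have hmul : ∀ g h, l (g * h) ≤ l g + l h := fun g h => by
    simp only [l]
    exact_mod_cast cosetWordLength_mul_le hT hcomm g h
  have hconst : ∀ x y, toRightCoset H x = toRightCoset H y → l x = l y :=
    fun x y => eq_of_toRightCoset_eq hmul hlH
  refine ⟨l, ⟨⟨?_, hlH 1 H.one_mem, fun g => ?_, hmul⟩, hlH⟩,
    isLocallyBoundedOnPair_of_toRightCoset_eq hconst, fun n => ?_⟩
  · borelize G
    exact (continuous_of_toRightCoset_eq hconst).measurable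
  · exact congrArg Nat.cast (cosetWordLength_inv hT hcomm hTinv g)
  · rw [closure_discrete]
    -- As `1 ∈ T`, powers of `T` increase, so the ball of radius `n` lies in `H Tⁿ`.
    refine ((finite_image_subgroup_mul (hTfin n)).subset (Set.image_mono fun g hg => ?_)).isCompact
    have hgn : cosetWordLength H T g ≤ n := by
      exact_mod_cast (show (cosetWordLength H T g : ℝ≥0) ≤ n from hg)
    exact Set.mul_subset_mul_left (Set.pow_subset_pow_right h1T hgn)
      (mem_mul_pow_cosetWordLength hT g)
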